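/- **Theorem 3.3.** For a positive semidefinite complex matrix $A$ (written $A\ge0$) let $s(A)$ be its support projection, i.e. the orthogonal projection onto the range of $A$, and let $A^{-1}$ denote the generalized inverse of $A$ (the inverse on the support, $0$ on its complement); for $r<0$ put $A^r:=(A^{-1})^{-r}$. For $0<\alpha<1$ and $p>0$, and for positive semidefinite $n\times n$ matrices $A,B$ with $s(A)\ge s(B)$, define $$A\#_\alpha B:=A^{1/2}(A^{-1/2}BA^{-1/2})^\alpha A^{1/2},\qquad A\#B:=A\#_{1/2}B,$$ $$F_\alpha(A,B):=(A^{-1}\#B)^\alpha A(A^{-1}\#B)^\alpha,\qquad SG_{\alpha,p}(A,B):=F_\alpha(A^p,B^p)^{1/p},$$ $$R_{\alpha,p}(A,B):=\bigl(A^{\frac{1-\alpha}2p}B^{\alpha p}A^{\frac{1-\alpha}2p}\bigr)^{1/p}.$$ For positive semidefinite $n\times n$ matrices $X,Y$ with eigenvalues $\lambda_1(\cdot)\ge\dots\ge\lambda_n(\cdot)$ (counted with multiplicity), $X\prec_{\log}Y$ means that $\prod_{i=1}^k\lambda_i(X)\le\prod_{i=1}^k\lambda_i(Y)$ for $1\le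 k\le n$, with equality for $k=n$. Let $0<\alpha<1$ and $p,q>0$. (1) The following conditions are equivalent: (i) $SG_{\alpha,p}(A,B)\prec_{\log}R_{\alpha,q}(A,B)$ for all $n$ and all positive semidefinite $n\times n$ complex matrices $A,B$ with $s(A)\ge s(B)$; (ii) $SG_{\alpha,p}(A,B)\prec_{\log}R_{\alpha,q}(A,B)$ for all positive definite $2\times2$ complex matrices $A,B$; (iii) $p/q\le\min\{\alpha,1-\alpha\}$. (2) The following conditions are equivalent: (i) $R_{\alpha,q}(A,B)\prec_{\log}SG_{\alpha,p}(A,B)$ for all $n$ and all positive semidefinite $n\times n$ complex matrices $A,B$ with $s(A)\ge s(B)$; (ii) $R_{\alpha,q}(A,B)\prec_{\log}SG_{\alpha,p}(A,B)$ for all positive definite $2\times2$ complex matrices $A,B$; (iii) $p/q\ge\max\{\alpha,1-\alpha\}$. -/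

import Mathlib

open scoped ComplexOrder MatrixOrder

noncomputable section

/-!
Real powers `A ^ r` of a positive semidefinite complex matrix are Mathlib's `CFC.rpow`, that is, the
functional calculus of `x ↦ x ^ r` on `[0, ∞)`. Since `(0 : ℝ≥0) ^ r = 0` for every `r ≠ 0`, a
negative power is the power of the generalized inverse (the inverse on the support of `A`), and
`A ^ (-1 : ℝ)` is the generalized inverse itself.
-/

/-- The support projection `s(A)` of a Hermitian matrix `A`: the spectral projection of `A` for the
nonzero part of the spectrum, that is, the orthogonal projection onto the range of `A`. -/
def supportProj {n : ℕ} (A : Matrix (Fin n) (Fin n) ℂ) : Matrix (Fin n) (Fin n) ℂ :=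
  cfc (fun x : ℝ => if x = 0 then 0 else 1) A

/-- The weighted geometric mean `A #_α B = A^{1/2} (A^{-1/2} B A^{-1/2})^α A^{1/2}`, for positive
definite `A, B` and, with generalized inverses, for positive semidefinite `A, B` with
`s(A) ≥ s(B)` (where it agrees with the limit of `(A + εI) #_α (B + εI)` as `ε ↘ 0`). -/
def geoMean {n : ℕ} (α : ℝ) (A B : Matrix (Fin n) (Fin n) ℂ) : Matrix (Fin n) (Fin n) ℂ :=
  A ^ (1 / 2 : ℝ) * (A ^ (-1 / 2 : ℝ) * B * A ^ (-1 / 2 : ℝ)) ^ α * A ^ (1 / 2 : ℝ)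

/-- The weighted spectral geometric mean `F_α(A, B) = (A⁻¹ # B)^α A (A⁻¹ # B)^α`, with the
generalized inverse of `A` and `# = #_{1/2}`. -/
def spectralGeoMean {n : ℕ} (α : ℝ) (A B : Matrix (Fin n) (Fin n) ℂ) :
    Matrix (Fin n) (Fin n) ℂ :=
  geoMean (1 / 2) (A ^ (-1 : ℝ)) B ^ α * A * geoMean (1 / 2) (A ^ (-1 : ℝ)) B ^ α

/-- The quasi weighted spectral geometric mean `SG_{α,p}(A, B) = F_α(A^p, B^p)^{1/p}`. -/
def SG {n : ℕ} (α p : ℝ) (A B : Matrix (Fin n) (Fin n) ℂ) : Matrix (Fin n) (Fin n) ℂ :=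
  spectralGeoMean α (A ^ p) (B ^ p) ^ (1 / p)

/-- The Rényi mean
`R_{α,p}(A, B) = (A^{(1-α)p/2} B^{αp} A^{(1-α)p/2})^{1/p}`. -/
def renyiMean {n : ℕ} (α p : ℝ) (A B : Matrix (Fin n) (Fin n) ℂ) : Matrix (Fin n) (Fin n) ℂ :=
  (A ^ ((1 - α) / 2 * p) * B ^ (α * p) * A ^ ((1 - α) / 2 * p)) ^ (1 / p)

/-- Log-majorization `X ≺_log Y` of positive semidefinite matrices. Here `eigenvalues₀` lists the
eigenvalues in decreasing order with multiplicities: for `1 ≤ k ≤ n` the product of the `k` largest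
eigenvalues of `X` is at most that of `Y`, with equality for `k = n`. -/
def LogMaj {n : ℕ} (X Y : Matrix (Fin n) (Fin n) ℂ) : Prop :=
  ∃ (hX : X.PosSemidef) (hY : Y.PosSemidef),
    (∀ k : ℕ, 1 ≤ k → k ≤ n →
      ∏ i with i.val < k, hX.isHermitian.eigenvalues₀ i ≤
        ∏ i with i.val < k, hY.isHermitian.eigenvalues₀ i) ∧
    ∏ i, hX.isHermitian.eigenvalues₀ i = ∏ i, hY.isHermitian.eigenvalues₀ i

end

/-
With `X = A^p`, `Y = B^p` and `r = q / p`, the claim compares `F_α(X, Y)^r` with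
`X^{(1-α)r/2} Y^{αr} X^{(1-α)r/2}`. Both sides commute with compound matrices and have the same
determinant, so log-majorization reduces to an inequality between operator norms, for `X`, `Y`
positive and invertible in any C⋆-algebra; semidefinite pairs follow by replacing `X` with
`X + (1 - s(X))`, and `Y` by a limit.

The mean `G = X⁻¹ # Y` is the positive solution of `G X G = Y`. If the sandwiched product is at
most `t`, then `Y^{αr} ≤ t X^{-(1-α)r}`. When `α r ≥ 1`, the Löwner–Heinz inequality bounds `Y`,
then `G`, and, for `α ≤ 1/2`, also `G^{2α}` by a power of `X`, which is the bound
`F_α(X, Y) ≤ t^{1/r}`. The symmetry `F_{1-α}(Y, X) = F_α(X, Y)` covers `α ≥ 1/2`. Conversely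
`F_α(X, Y) ≤ t` bounds both `X` and `Y = G X G` by multiples of powers of `G`, and Löwner–Heinz
applies as soon as `α r` and `(1-α) r` are at most `1`.

For the necessity, take `X = diag(1, 3)` and `Y` the projection onto the line spanned by `(1, 1)`:
the two norms are `2^s` and `(1 + 3^s) / 2` with `s = (1-α) r`, and the strict convexity or
concavity of `x ↦ x^s` decides which one is larger. Exchanging `X` and `Y` gives the condition on
`α r`.
-/

noncomputable section

section Powers

open CFC

variable {𝒜 : Type*} [CStarAlgebra 𝒜] [PartialOrder 𝒜] [StarOrderedRing 𝒜] {a b c x : 𝒜}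

lemma isSelfAdjoint_rpow (a : 𝒜) (r : ℝ) : IsSelfAdjoint (a ^ r) :=
  (rpow_nonneg (a := a) (y := r)).isSelfAdjoint

lemma conj_rpow_nonneg (hc : 0 ≤ c) (a : 𝒜) (r : ℝ) : 0 ≤ a ^ r * c * a ^ r :=
  (isSelfAdjoint_rpow a r).conjugate_nonneg hc

lemma conj_rpow_le_conj_rpow (h : b ≤ c) (a : 𝒜) (r : ℝ) :
    a ^ r * b * a ^ r ≤ a ^ r * c * a ^ r :=
  (isSelfAdjoint_rpow a r).conjugate_le_conjugate h

lemma smul_rpow {k : ℝ} (hk : 0 < k) (ha : 0 ≤ a) {r : ℝ} (h : IsUnit a ∨ 0 ≤ r) :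
    (k • a) ^ r = k ^ r • a ^ r := by
  have hcont : ContinuousOn (fun x : ℝ => x ^ r) (spectrum ℝ a) := fun x hx =>
    (Real.continuousAt_rpow_const _ _ (h.imp_left fun hu hx0 =>
      spectrum.zero_notMem _ hu (hx0 ▸ hx))).continuousWithinAt
  have hmul : ∀ x ∈ spectrum ℝ a, (k • x) ^ r = k ^ r • x ^ r := fun x hx =>
    Real.mul_rpow hk.le (spectrum_nonneg_of_nonneg ha hx)
  have hcont' : ContinuousOn (fun x : ℝ => x ^ r) ((fun x => k • x) '' spectrum ℝ a) := by
    rintro _ ⟨x, hx, rfl⟩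
    refine (Real.continuousAt_rpow_const _ _ (h.imp_left fun hu hx0 => ?_)).continuousWithinAt
    rcases smul_eq_zero.1 hx0 with hk0 | rfl
    · exact hk.ne' hk0
    · exact spectrum.zero_notMem _ hu hx
  rw [rpow_eq_cfc_real (smul_nonneg hk.le ha), rpow_eq_cfc_real ha, ← cfc_smul _ _ _ hcont,
    ← cfc_comp_smul k (fun x : ℝ => x ^ r) a hcont']
  exact cfc_congr hmul

lemma rpow_rpow_of_isStrictlyPositive (ha : IsStrictlyPositive a) (r s : ℝ) :
    (a ^ r) ^ s = a ^ (r * s) := by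
  rcases eq_or_ne r 0 with rfl | hr
  · rw [rpow_zero a, one_rpow, zero_mul, rpow_zero a]
  · exact rpow_rpow a r s hr

lemma rpow_conj_rpow (ha : IsStrictlyPositive a) (r s : ℝ) :
    a ^ r * a ^ s * a ^ r = a ^ (r + s + r) := by
  rw [rpow_add ha.isUnit, rpow_add ha.isUnit]

lemma conj_rpow_conj_rpow_neg (ha : IsStrictlyPositive a) (c : 𝒜) (r : ℝ) :
    a ^ r * (a ^ (-r) * c * a ^ (-r)) * a ^ r = c :=
  calc _ = (a ^ r * a ^ (-r)) * c * (a ^ (-r) * a ^ r) := by simp only [mul_assoc]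
    _ = c := by rw [rpow_mul_rpow_neg, rpow_neg_mul_rpow, one_mul, mul_one]

lemma rpow_half_mul_self (ha : 0 ≤ a) : a ^ (1 / 2 : ℝ) * a ^ (1 / 2 : ℝ) = a := by
  rw [← sqrt_eq_rpow, sqrt_mul_sqrt_self a ha]

lemma isStrictlyPositive_conj_rpow (ha : IsStrictlyPositive a) (hc : IsStrictlyPositive c)
    (r : ℝ) : IsStrictlyPositive (a ^ r * c * a ^ r) :=
  IsStrictlyPositive.iff_of_unital.2 ⟨conj_rpow_nonneg hc.nonneg a r,
    ((ha.rpow a r).isUnit.mul hc.isUnit).mul (ha.rpow a r).isUnit⟩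

lemma norm_conj_rpow_half_comm (ha : IsStrictlyPositive a) (hb : IsStrictlyPositive b)
    (r s : ℝ) : ‖a ^ (r / 2) * b ^ s * a ^ (r / 2)‖ = ‖b ^ (s / 2) * a ^ r * b ^ (s / 2)‖ := by
  set u := a ^ (r / 2)
  set v := b ^ (s / 2)
  have hu : star u = u := isSelfAdjoint_rpow a _
  have hv : star v = v := isSelfAdjoint_rpow b _
  calc _ = ‖star (v * u) * (v * u)‖ := by
        rw [star_mul, hu, hv, mul_assoc u v, ← mul_assoc v v, ← rpow_add hb.isUnit, add_halves,
          mul_assoc]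
    _ = ‖(v * u) * star (v * u)‖ := by
        rw [CStarRing.norm_star_mul_self, CStarRing.norm_self_mul_star]
    _ = _ := by
        rw [star_mul, hu, hv, mul_assoc v u, ← mul_assoc u u, ← rpow_add ha.isUnit, add_halves,
          mul_assoc]

lemma norm_conj_rpow_half_le_iff (ha : IsStrictlyPositive a) (hc : 0 ≤ c) (r : ℝ) {t : ℝ}
    (ht : 0 ≤ t) : ‖a ^ (r / 2) * c * a ^ (r / 2)‖ ≤ t ↔ c ≤ t • a ^ (-r) := by
  rw [CStarAlgebra.norm_le_iff_le_algebraMap _ ht (conj_rpow_nonneg hc a _),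
    Algebra.algebraMap_eq_smul_one]
  constructor <;> intro h
  · have := conj_rpow_le_conj_rpow h a (-(r / 2))
    rw [mul_smul_comm, mul_one, smul_mul_assoc, ← rpow_add ha.isUnit] at this
    convert this using 1
    · simpa only [neg_neg] using (conj_rpow_conj_rpow_neg ha c (-(r / 2))).symm
    · ring_nf
  · refine (conj_rpow_le_conj_rpow h a (r / 2)).trans_eq ?_
    rw [mul_smul_comm, smul_mul_assoc, rpow_conj_rpow ha]
    ring_nf
    rw [rpow_zero a]

lemma rpow_le_smul_rpow {t : ℝ} (ht : 0 < t) (ha : IsStrictlyPositive a) {v u : ℝ}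
    (hu : u ∈ Set.Icc (0 : ℝ) 1) (h : b ≤ t • a ^ v) : b ^ u ≤ t ^ u • a ^ (v * u) := by
  rw [← rpow_rpow_of_isStrictlyPositive ha, ← smul_rpow ht rpow_nonneg (.inr hu.1)]
  exact rpow_le_rpow hu h

end Powers

section Means

open CFC

variable {𝒜 : Type*} [CStarAlgebra 𝒜] [PartialOrder 𝒜] [StarOrderedRing 𝒜] {g x y z : 𝒜}

/-- The geometric mean `x⁻¹ # y`, which for strictly positive `x` and nonnegative `y` is the
nonnegative solution `g` of the Riccati equation `g x g = y`. -/
def invGeoMean (x y : 𝒜) : 𝒜 :=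
  x ^ (-(1 / 2) : ℝ) * (x ^ (1 / 2 : ℝ) * y * x ^ (1 / 2 : ℝ)) ^ (1 / 2 : ℝ) *
    x ^ (-(1 / 2) : ℝ)

/-- The weighted spectral geometric mean `F_α(x, y)` in a C⋆-algebra. -/
def specMean (α : ℝ) (x y : 𝒜) : 𝒜 := invGeoMean x y ^ α * x * invGeoMean x y ^ α

/-- The sandwiched product `R_{α,r}(x, y)^r`, that is, the Rényi mean before the outer
power `1 / r` is taken. -/
def renyiSandwich (α r : ℝ) (x y : 𝒜) : 𝒜 :=
  x ^ ((1 - α) * r / 2) * y ^ (α * r) * x ^ ((1 - α) * r / 2)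

lemma invGeoMean_nonneg (x y : 𝒜) : 0 ≤ invGeoMean x y :=
  conj_rpow_nonneg rpow_nonneg x _

lemma specMean_nonneg (α : ℝ) (hx : 0 ≤ x) (y : 𝒜) : 0 ≤ specMean α x y :=
  conj_rpow_nonneg hx _ α

lemma renyiSandwich_nonneg (α r : ℝ) (x y : 𝒜) : 0 ≤ renyiSandwich α r x y :=
  conj_rpow_nonneg rpow_nonneg x _

lemma isStrictlyPositive_invGeoMean (hx : IsStrictlyPositive x) (hy : IsStrictlyPositive y) :
    IsStrictlyPositive (invGeoMean x y) :=
  isStrictlyPositive_conj_rpow hx ((isStrictlyPositive_conj_rpow hx hy _).rpow _ _) _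

lemma isStrictlyPositive_specMean (hx : IsStrictlyPositive x) (hy : IsStrictlyPositive y)
    (α : ℝ) : IsStrictlyPositive (specMean α x y) :=
  isStrictlyPositive_conj_rpow (isStrictlyPositive_invGeoMean hx hy) hx α

lemma invGeoMean_mul_mul_self (hx : IsStrictlyPositive x) (hy : 0 ≤ y) :
    invGeoMean x y * x * invGeoMean x y = y := by
  unfold invGeoMean
  set m := x ^ (1 / 2 : ℝ) * y * x ^ (1 / 2 : ℝ)
  have hx1 : x ^ (-(1 / 2) : ℝ) * x * x ^ (-(1 / 2) : ℝ) = 1 := by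
    nth_rw 2 [← rpow_one x]
    rw [rpow_conj_rpow hx]
    norm_num [rpow_zero x]
  calc _ = x ^ (-(1 / 2) : ℝ) * m ^ (1 / 2 : ℝ) *
        (x ^ (-(1 / 2) : ℝ) * x * x ^ (-(1 / 2) : ℝ)) * m ^ (1 / 2 : ℝ) * x ^ (-(1 / 2) : ℝ) := by
        simp only [mul_assoc]
    _ = x ^ (-(1 / 2) : ℝ) * (m ^ (1 / 2 : ℝ) * m ^ (1 / 2 : ℝ)) * x ^ (-(1 / 2) : ℝ) := by
        rw [hx1]; simp only [mul_assoc, mul_one]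
    _ = y := by
        rw [rpow_half_mul_self (conj_rpow_nonneg hy x _)]
        simpa only [neg_neg] using conj_rpow_conj_rpow_neg hx y (-(1 / 2))

lemma eq_invGeoMean_of_mul_mul_self (hx : IsStrictlyPositive x) (hg : 0 ≤ g)
    (h : g * x * g = y) : g = invGeoMean x y := by
  have hsq : (x ^ (1 / 2 : ℝ) * g * x ^ (1 / 2 : ℝ)) * (x ^ (1 / 2 : ℝ) * g * x ^ (1 / 2 : ℝ)) =
      x ^ (1 / 2 : ℝ) * y * x ^ (1 / 2 : ℝ) := by
    rw [← h]
    nth_rw 6 [← rpow_half_mul_self hx.nonneg]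
    simp only [mul_assoc]
  rw [invGeoMean, ← sqrt_eq_rpow, ← hsq, sqrt_mul_self _ (conj_rpow_nonneg hg x _)]
  simpa only [neg_neg] using (conj_rpow_conj_rpow_neg hx g (-(1 / 2))).symm

lemma invGeoMean_swap (hx : IsStrictlyPositive x) (hy : IsStrictlyPositive y) :
    invGeoMean y x = invGeoMean x y ^ (-1 : ℝ) := by
  refine (eq_invGeoMean_of_mul_mul_self hy rpow_nonneg ?_).symm
  have hg := isStrictlyPositive_invGeoMean hx hy
  have h := conj_rpow_conj_rpow_neg hg x (-1)
  rwa [neg_neg, rpow_one (invGeoMean x y), invGeoMean_mul_mul_self hx hy.nonneg] at h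

lemma specMean_swap (hx : IsStrictlyPositive x) (hy : IsStrictlyPositive y) (α : ℝ) :
    specMean (1 - α) y x = specMean α x y := by
  have hg := isStrictlyPositive_invGeoMean hx hy
  unfold specMean
  rw [invGeoMean_swap hx hy, rpow_rpow_of_isStrictlyPositive hg]
  nth_rw 2 [← invGeoMean_mul_mul_self hx hy.nonneg]
  set g := invGeoMean x y
  have h1 : g ^ (-1 * (1 - α)) * g = g ^ α := by
    nth_rw 2 [← rpow_one g]
    rw [← rpow_add hg.isUnit]
    ring_nf
  have h2 : g * g ^ (-1 * (1 - α)) = g ^ α := by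
    nth_rw 1 [← rpow_one g]
    rw [← rpow_add hg.isUnit]
    ring_nf
  calc _ = (g ^ (-1 * (1 - α)) * g) * x * (g * g ^ (-1 * (1 - α))) := by simp only [mul_assoc]
    _ = _ := by rw [h1, h2]

lemma norm_renyiSandwich_swap (hx : IsStrictlyPositive x) (hy : IsStrictlyPositive y)
    (α r : ℝ) : ‖renyiSandwich (1 - α) r y x‖ = ‖renyiSandwich α r x y‖ := by
  rw [renyiSandwich, sub_sub_cancel, norm_conj_rpow_half_comm hy hx, renyiSandwich]

lemma invGeoMean_le (h : y ≤ z) : invGeoMean x y ≤ invGeoMean x z :=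
  conj_rpow_le_conj_rpow
    (rpow_le_rpow ⟨by norm_num, by norm_num⟩ (conj_rpow_le_conj_rpow h _ _)) _ _

lemma invGeoMean_smul_rpow (hx : IsStrictlyPositive x) {k : ℝ} (hk : 0 < k) (v : ℝ) :
    invGeoMean x (k • x ^ v) = k ^ (1 / 2 : ℝ) • x ^ ((v - 1) / 2) := by
  refine (eq_invGeoMean_of_mul_mul_self hx (smul_nonneg (by positivity) rpow_nonneg) ?_).symm
  have h := rpow_conj_rpow hx ((v - 1) / 2) 1
  rw [rpow_one x] at h
  simp only [smul_mul_assoc, mul_smul_comm, smul_smul, h]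
  congr 2
  · rw [← Real.rpow_add hk]; norm_num
  · ring

lemma norm_specMean_eq (hx : IsStrictlyPositive x) (hy : IsStrictlyPositive y) (α : ℝ) :
    ‖specMean α x y‖ =
      ‖x ^ (1 / 2 : ℝ) * invGeoMean x y ^ (2 * α) * x ^ (1 / 2 : ℝ)‖ := by
  rw [norm_conj_rpow_half_comm hx (isStrictlyPositive_invGeoMean hx hy), rpow_one x,
    mul_div_cancel_left₀ _ two_ne_zero, specMean]

end Means

section NormInequalities

open CFC Set Topology

variable {𝒜 : Type*} [CStarAlgebra 𝒜] [PartialOrder 𝒜] [StarOrderedRing 𝒜] {x y : 𝒜} {α r : ℝ}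

lemma norm_specMean_rpow_le_of_le_half (hx : IsStrictlyPositive x) (hy : IsStrictlyPositive y)
    (hα : 0 < α) (hα2 : α ≤ 1 / 2) (hr : 1 ≤ α * r) :
    ‖specMean α x y‖ ^ r ≤ ‖renyiSandwich α r x y‖ := by
  refine le_of_forall_gt_imp_ge_of_dense fun t ht => ?_
  have ht0 : 0 < t := (norm_nonneg _).trans_lt ht
  have hr0 : 0 < r := pos_of_mul_pos_right (zero_lt_one.trans_le hr) hα.le
  set G := invGeoMean x y
  have hy1 : y ^ (α * r) ≤ t • x ^ (-((1 - α) * r)) :=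
    (norm_conj_rpow_half_le_iff hx rpow_nonneg _ ht0.le).1 ht.le
  have hy2 : y ≤ t ^ (α * r)⁻¹ • x ^ (-((1 - α) * r) * (α * r)⁻¹) := by
    have := rpow_le_smul_rpow ht0 hx (u := (α * r)⁻¹)
      ⟨by positivity, inv_le_one_of_one_le₀ hr⟩ hy1
    rwa [rpow_rpow_of_isStrictlyPositive hy, mul_inv_cancel₀ (by positivity), rpow_one y] at this
  have hG : G ≤ (t ^ (α * r)⁻¹) ^ (1 / 2 : ℝ) • x ^ ((-((1 - α) * r) * (α * r)⁻¹ - 1) / 2) :=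
    (invGeoMean_le hy2).trans_eq (invGeoMean_smul_rpow hx (by positivity) _)
  have hG2 : G ^ (2 * α) ≤ t ^ r⁻¹ • x ^ (-1 : ℝ) := by
    refine (rpow_le_smul_rpow (by positivity) hx ⟨by positivity, by linarith⟩ hG).trans_eq ?_
    rw [← Real.rpow_mul ht0.le, ← Real.rpow_mul ht0.le]
    congr 2 <;> field_simp
    ring
  have hle : ‖specMean α x y‖ ≤ t ^ r⁻¹ := by
    rw [norm_specMean_eq hx hy]
    exact (norm_conj_rpow_half_le_iff hx rpow_nonneg _ (by positivity)).2 hG2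
  calc ‖specMean α x y‖ ^ r ≤ (t ^ r⁻¹) ^ r := by gcongr
    _ = t := Real.rpow_inv_rpow ht0.le hr0.ne'

lemma norm_specMean_rpow_le (hx : IsStrictlyPositive x) (hy : IsStrictlyPositive y)
    (hα : α ∈ Ioo (0 : ℝ) 1) (hr : 1 ≤ α * r) (hr' : 1 ≤ (1 - α) * r) :
    ‖specMean α x y‖ ^ r ≤ ‖renyiSandwich α r x y‖ := by
  rcases le_total α (1 / 2) with h | h
  · exact norm_specMean_rpow_le_of_le_half hx hy hα.1 h hr
  · rw [← specMean_swap hx hy, ← norm_renyiSandwich_swap hx hy]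
    exact norm_specMean_rpow_le_of_le_half hy hx (sub_pos.2 hα.2) (by linarith) hr'

lemma norm_conj_rpow_half_le_mul {g : 𝒜} (hx : IsStrictlyPositive x)
    (hg : IsStrictlyPositive g) {k l u v w : ℝ} (hk : 0 ≤ k) (hl : 0 ≤ l)
    (hxg : x ^ u ≤ k • g ^ (-w)) (hyg : y ^ v ≤ l • g ^ w) :
    ‖x ^ (u / 2) * y ^ v * x ^ (u / 2)‖ ≤ k * l := by
  have hle : ‖x ^ (u / 2) * y ^ v * x ^ (u / 2)‖ ≤ ‖x ^ (u / 2) * (l • g ^ w) * x ^ (u / 2)‖ :=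
    CStarAlgebra.norm_le_norm_of_nonneg_of_le (conj_rpow_nonneg rpow_nonneg x _)
      (conj_rpow_le_conj_rpow hyg x _)
  calc _ ≤ l * ‖x ^ (u / 2) * g ^ w * x ^ (u / 2)‖ := by
        rwa [mul_smul_comm, smul_mul_assoc, norm_smul, Real.norm_of_nonneg hl] at hle
    _ = l * ‖g ^ (w / 2) * x ^ u * g ^ (w / 2)‖ := by rw [norm_conj_rpow_half_comm hx hg]
    _ ≤ l * k := by
        gcongr
        exact (norm_conj_rpow_half_le_iff hg rpow_nonneg _ hk).2 hxg
    _ = k * l := mul_comm l k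

lemma norm_renyiSandwich_le (hx : IsStrictlyPositive x) (hy : IsStrictlyPositive y)
    (hα : α ∈ Ioo (0 : ℝ) 1) (hr0 : 0 < r) (hr : α * r ≤ 1) (hr' : (1 - α) * r ≤ 1) :
    ‖renyiSandwich α r x y‖ ≤ ‖specMean α x y‖ ^ r := by
  have hα0 : 0 < α := hα.1
  have hα1 : 0 < 1 - α := sub_pos.2 hα.2
  cases subsingleton_or_nontrivial 𝒜
  · rw [norm_of_subsingleton]
    positivity
  set t := ‖specMean α x y‖ with ht
  have ht0 : 0 < t := norm_pos_iff.2 (isStrictlyPositive_specMean hx hy α).isUnit.ne_zero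
  set G := invGeoMean x y
  have hG : IsStrictlyPositive G := isStrictlyPositive_invGeoMean hx hy
  have hxG : x ≤ t • G ^ (-(2 * α)) := by
    refine (norm_conj_rpow_half_le_iff hG hx.nonneg _ ht0.le).1 (le_of_eq ?_)
    rw [mul_div_cancel_left₀ _ two_ne_zero, ht, specMean]
  have hyG : y ≤ t • G ^ (2 * (1 - α)) := by
    have h := conj_rpow_le_conj_rpow hxG G 1
    rw [mul_smul_comm, smul_mul_assoc, rpow_conj_rpow hG, rpow_one G,
      invGeoMean_mul_mul_self hx hy.nonneg] at h
    convert h using 3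
    ring
  have hxu := rpow_le_smul_rpow ht0 hG ⟨by positivity, hr'⟩ hxG
  have hyv := rpow_le_smul_rpow ht0 hG ⟨by positivity, hr⟩ hyG
  rw [show -(2 * α) * ((1 - α) * r) = -(2 * (1 - α) * (α * r)) by ring] at hxu
  calc ‖renyiSandwich α r x y‖ ≤ t ^ ((1 - α) * r) * t ^ (α * r) :=
        norm_conj_rpow_half_le_mul hx hG (by positivity) (by positivity) hxu hyv
    _ = t ^ r := by rw [← Real.rpow_add ht0]; ring_nf

lemma continuousOn_rpow_of_pos {s : ℝ} (hs : 0 < s) :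
    ContinuousOn (fun a : 𝒜 => a ^ s) (Ici 0) := by
  lift s to NNReal using hs.le
  simp_rw [← nnrpow_eq_rpow (NNReal.coe_pos.1 hs)]
  exact continuousOn_nnrpow s

lemma continuousOn_invGeoMean (x : 𝒜) : ContinuousOn (invGeoMean x) (Ici 0) := by
  have hconj : ContinuousOn (fun y => x ^ (1 / 2 : ℝ) * y * x ^ (1 / 2 : ℝ)) (Ici 0) := by fun_prop
  have hmaps : MapsTo (fun y => x ^ (1 / 2 : ℝ) * y * x ^ (1 / 2 : ℝ)) (Ici 0) (Ici 0) :=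
    fun y hy => conj_rpow_nonneg hy x _
  exact (continuousOn_const.mul
    ((continuousOn_rpow_of_pos one_half_pos).comp hconj hmaps)).mul continuousOn_const

lemma continuousOn_specMean (hα : 0 < α) (x : 𝒜) : ContinuousOn (specMean α x) (Ici 0) := by
  have h : ContinuousOn (fun y => invGeoMean x y ^ α) (Ici 0) :=
    (continuousOn_rpow_of_pos hα).comp (continuousOn_invGeoMean x)
      fun y _ => invGeoMean_nonneg x y
  exact (h.mul continuousOn_const).mul h

lemma continuousOn_renyiSandwich (h : 0 < α * r) (x : 𝒜) :
    ContinuousOn (renyiSandwich α r x) (Ici 0) :=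
  (continuousOn_const.mul (continuousOn_rpow_of_pos h)).mul continuousOn_const

lemma mem_closure_isStrictlyPositive (hy : 0 ≤ y) :
    y ∈ closure {z : 𝒜 | IsStrictlyPositive z} := by
  have hlim : Filter.Tendsto (fun ε : ℝ => y + ε • (1 : 𝒜)) (𝓝[>] 0) (𝓝 y) := by
    have : Continuous fun ε : ℝ => y + ε • (1 : 𝒜) := by fun_prop
    simpa using (this.tendsto 0).mono_left nhdsWithin_le_nhds
  refine mem_closure_of_tendsto hlim (Filter.eventually_of_mem self_mem_nhdsWithin fun ε hε => ?_)
  exact IsStrictlyPositive.nonneg_add hy (IsStrictlyPositive.smul hε isStrictlyPositive_one)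

lemma le_of_forall_isStrictlyPositive_le {f g : 𝒜 → ℝ} (hf : ContinuousOn f (Ici 0))
    (hg : ContinuousOn g (Ici 0)) (h : ∀ z, IsStrictlyPositive z → f z ≤ g z) (hy : 0 ≤ y) :
    f y ≤ g y := by
  have hsub : {z : 𝒜 | IsStrictlyPositive z} ⊆ Ici 0 := fun z hz => hz.nonneg
  exact ContinuousWithinAt.closure_le (mem_closure_isStrictlyPositive hy)
    ((hf y hy).mono hsub) ((hg y hy).mono hsub) h

lemma norm_specMean_rpow_le_of_forall_isStrictlyPositive (hα : 0 < α) (hr : 0 < r)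
    (h : ∀ z, IsStrictlyPositive z → ‖specMean α x z‖ ^ r ≤ ‖renyiSandwich α r x z‖)
    (hy : 0 ≤ y) : ‖specMean α x y‖ ^ r ≤ ‖renyiSandwich α r x y‖ :=
  le_of_forall_isStrictlyPositive_le
    ((continuousOn_specMean hα x).norm.rpow_const fun _ _ => .inr hr.le)
    (continuousOn_renyiSandwich (mul_pos hα hr) x).norm h hy

lemma norm_renyiSandwich_le_of_forall_isStrictlyPositive (hα : 0 < α) (hr : 0 < r)
    (h : ∀ z, IsStrictlyPositive z → ‖renyiSandwich α r x z‖ ≤ ‖specMean α x z‖ ^ r)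
    (hy : 0 ≤ y) : ‖renyiSandwich α r x y‖ ≤ ‖specMean α x y‖ ^ r :=
  le_of_forall_isStrictlyPositive_le (continuousOn_renyiSandwich (mul_pos hα hr) x).norm
    ((continuousOn_specMean hα x).norm.rpow_const fun _ _ => .inr hr.le) h hy

end NormInequalities

section Spectral

open Matrix Unitary

variable {ι : Type*} [Fintype ι] [DecidableEq ι] {A : Matrix ι ι ℂ}

lemma conjStarAlgAut_eq_iff {R : Type*} [Ring R] [StarRing R] [Algebra ℂ R] (U V : unitary R)
    (x y : R) :
    conjStarAlgAut ℂ R U x = conjStarAlgAut ℂ R V y ↔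
      x * (star U * V : unitary R) = (star U * V : unitary R) * y := by
  rw [← EmbeddingLike.apply_eq_iff_eq (conjStarAlgAut ℂ R (star U)), ← conjStarAlgAut_mul_apply,
    ← conjStarAlgAut_mul_apply, star_mul_self]
  simp only [map_one, conjStarAlgAut_apply, StarAlgEquiv.one_apply]
  constructor
  · intro h
    rw [h, mul_assoc, coe_star_mul_self, mul_one]
  · intro h
    rw [← h, mul_assoc, mul_star_self_of_mem (star U * V).2, mul_one]

lemma diagonal_mul_eq_mul_diagonal_comp {c d : ι → ℝ} {W : Matrix ι ι ℂ}
    (h : diagonal (Complex.ofReal ∘ c) * W = W * diagonal (Complex.ofReal ∘ d)) (f : ℝ → ℝ) :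
    diagonal (Complex.ofReal ∘ f ∘ c) * W = W * diagonal (Complex.ofReal ∘ f ∘ d) := by
  ext i j
  have hij := congrFun₂ h i j
  simp only [diagonal_mul, mul_diagonal, Function.comp_apply] at hij ⊢
  rcases eq_or_ne (W i j) 0 with hW | hW
  · simp only [hW, mul_zero, zero_mul]
  · have hcd : c i = d j :=
      Complex.ofReal_injective (mul_right_cancel₀ hW (hij.trans (mul_comm _ _)))
    rw [hcd, mul_comm]

lemma isHermitian_conj_diagonal (V : unitaryGroup ι ℂ) (d : ι → ℝ) :
    (conjStarAlgAut ℂ _ V (diagonal (Complex.ofReal ∘ d))).IsHermitian :=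
  IsSelfAdjoint.map (isHermitian_diagonal_iff.2 fun i => Complex.conj_ofReal (d i)).isSelfAdjoint
    (conjStarAlgAut ℂ (Matrix ι ι ℂ) V)

lemma cfc_conj_diagonal (V : unitaryGroup ι ℂ) (d : ι → ℝ) (f : ℝ → ℝ) :
    cfc f (conjStarAlgAut ℂ _ V (diagonal (Complex.ofReal ∘ d))) =
      conjStarAlgAut ℂ _ V (diagonal (Complex.ofReal ∘ f ∘ d)) := by
  have hA := isHermitian_conj_diagonal V d
  rw [hA.cfc_eq]
  exact (conjStarAlgAut_eq_iff _ _ _ _).2 (diagonal_mul_eq_mul_diagonal_comp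
    ((conjStarAlgAut_eq_iff _ _ _ _).1 hA.spectral_theorem.symm) f)

lemma rpow_conj_diagonal (V : unitaryGroup ι ℂ) {d : ι → ℝ} (hd : 0 ≤ d) (r : ℝ) :
    conjStarAlgAut ℂ _ V (diagonal (Complex.ofReal ∘ d)) ^ r =
      conjStarAlgAut ℂ _ V (diagonal (Complex.ofReal ∘ fun i => d i ^ r)) := by
  have h0 : 0 ≤ diagonal (Complex.ofReal ∘ d) :=
    (PosSemidef.diagonal fun i => Complex.zero_le_real.2 (hd i)).nonneg
  rw [CFC.rpow_eq_cfc_real (map_nonneg (conjStarAlgAut ℂ _ V) h0), cfc_conj_diagonal]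
  rfl

lemma posSemidef_rpow (A : Matrix ι ι ℂ) (r : ℝ) : (A ^ r).PosSemidef :=
  nonneg_iff_posSemidef.1 CFC.rpow_nonneg

lemma norm_det_rpow (hA : A.PosSemidef) (r : ℝ) : ‖(A ^ r).det‖ = ‖A.det‖ ^ r := by
  have hdet : ∀ d : ι → ℝ, 0 ≤ d →
      ‖(conjStarAlgAut ℂ _ hA.1.eigenvectorUnitary (diagonal (Complex.ofReal ∘ d))).det‖ =
        ∏ i, d i := fun d hd => by
    rw [conjStarAlgAut_apply, det_mul_right_comm, mul_star_self_of_mem (SetLike.coe_mem _), one_mul,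
      det_diagonal, norm_prod]
    exact Finset.prod_congr rfl fun i _ => Complex.norm_of_nonneg (hd i)
  have h0 : 0 ≤ hA.1.eigenvalues := hA.eigenvalues_nonneg
  have hspec := hA.1.spectral_theorem
  calc ‖(A ^ r).det‖ = ∏ i, hA.1.eigenvalues i ^ r := by
        conv_lhs => rw [hspec]
        exact (congrArg (‖det ·‖) (rpow_conj_diagonal _ h0 r)).trans
          (hdet _ fun i => Real.rpow_nonneg (h0 i) r)
    _ = (∏ i, hA.1.eigenvalues i) ^ r := Real.finsetProd_rpow _ _ (fun i _ => h0 i) r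
    _ = ‖A.det‖ ^ r := by
        conv_rhs => rw [hspec]
        exact congrArg (· ^ r) (hdet _ h0).symm

end Spectral

section Compound

open Matrix Set

variable {ι R : Type*} [LinearOrder ι] [CommRing R] {k : ℕ}

lemma map_ιMulti_family_of_eigenbasis {M : Type*} [AddCommGroup M] [Module R M] {f : M →ₗ[R] M}
    {b : ι → M} {d : ι → R} (h : ∀ i, f (b i) = d i • b i) (s : powersetCard ι k) :
    exteriorPower.map k f (exteriorPower.ιMulti_family R k b s) =
      (∏ i ∈ s.1, d i) • exteriorPower.ιMulti_family R k b s := by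
  have hcomp : (f ∘ b) ∘ powersetCard.ofFinEmbEquiv.symm s = fun j =>
      d (powersetCard.ofFinEmbEquiv.symm s j) • (b ∘ powersetCard.ofFinEmbEquiv.symm s) j :=
    funext fun j => h _
  rw [exteriorPower.map_apply_ιMulti_family, exteriorPower.ιMulti_family,
    exteriorPower.ιMulti_family, hcomp, AlternatingMap.map_smul_univ]
  conv_rhs => rw [← Finset.image_orderEmbOfFin_univ s.1 s.2,
    Finset.prod_image (fun _ _ _ _ h => (s.1.orderEmbOfFin s.2).injective h)]
  rfl

variable [Fintype ι]

/-- The `k`-th compound matrix of `A`, defined as the matrix of the `k`-th exterior power of the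
linear map `A`. Its entries are the `k × k` minors of `A`, see `compound_apply`. -/
def compound (k : ℕ) (A : Matrix ι ι R) : Matrix (powersetCard ι k) (powersetCard ι k) R :=
  LinearMap.toMatrix ((Pi.basisFun R ι).exteriorPower k) ((Pi.basisFun R ι).exteriorPower k)
    (exteriorPower.map k (toLin' A))

lemma compound_mul (A B : Matrix ι ι R) : compound k (A * B) = compound k A * compound k B := by
  rw [compound, toLin'_mul, exteriorPower.map_comp,
    LinearMap.toMatrix_comp _ ((Pi.basisFun R ι).exteriorPower k)]
  rfl

lemma compound_one : compound k (1 : Matrix ι ι R) = 1 := by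
  rw [compound, toLin'_one, exteriorPower.map_id, LinearMap.toMatrix_id]

lemma compound_apply (A : Matrix ι ι R) (s t : powersetCard ι k) :
    compound k A s t = (A.submatrix (powersetCard.ofFinEmbEquiv.symm s)
      (powersetCard.ofFinEmbEquiv.symm t)).det := by
  rw [compound, LinearMap.toMatrix_apply, exteriorPower.basis_apply,
    exteriorPower.basis_repr_apply, exteriorPower.map_apply_ιMulti_family,
    exteriorPower.ιMulti_family, exteriorPower.ιMultiDual_apply_ιMulti, ← det_transpose]
  congr 1
  ext i j
  simp

lemma compound_conjTranspose [StarRing R] (A : Matrix ι ι R) : compound k Aᴴ = (compound k A)ᴴ := by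
  ext s t
  rw [conjTranspose_apply, compound_apply, compound_apply, ← det_conjTranspose,
    conjTranspose_submatrix]

lemma compound_diagonal (d : ι → R) :
    compound k (diagonal d) = diagonal fun s : powersetCard ι k => ∏ i ∈ s.1, d i := by
  have heig : ∀ i, toLin' (diagonal d) (Pi.basisFun R ι i) = d i • Pi.basisFun R ι i := fun i => by
    ext j
    rcases eq_or_ne j i with rfl | hj
    · simp
    · simp [hj]
  ext s t
  rw [compound, LinearMap.toMatrix_apply, exteriorPower.basis_apply,
    map_ιMulti_family_of_eigenbasis heig, map_smul, ← exteriorPower.basis_apply,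
    Module.Basis.repr_self, Finsupp.smul_single, smul_eq_mul, mul_one, Finsupp.single_apply,
    diagonal_apply]
  split_ifs with hts hst hst
  · rw [hts]
  · exact absurd hts.symm hst
  · exact absurd hst.symm hts
  · rfl

end Compound

section InitialProducts

lemma castLE_le_orderEmbOfFin {m : ℕ} (T : Finset (Fin m)) (hle : T.card ≤ m) (j : Fin T.card) :
    Fin.castLE hle j ≤ T.orderEmbOfFin rfl j := by
  have := Finset.card_le_card_of_injOn (s := Finset.Iio j)
    (t := Finset.Iio (T.orderEmbOfFin rfl j)) (T.orderEmbOfFin rfl)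
    (fun i hi => by simpa using hi) (T.orderEmbOfFin rfl).injective.injOn
  simpa [Fin.le_def] using this

lemma prod_filter_val_lt {M : Type*} [CommMonoid M] {m k : ℕ} (f : Fin m → M) (hle : k ≤ m) :
    ∏ i with i.val < k, f i = ∏ j : Fin k, f (Fin.castLE hle j) := by
  have himage : Finset.univ.filter (fun i : Fin m => i.val < k) =
      Finset.univ.map (Fin.castLEEmb hle) := by
    ext i
    simp only [Finset.mem_filter, Finset.mem_univ, true_and, Finset.mem_map]
    exact ⟨fun h => ⟨⟨i, h⟩, rfl⟩, fun ⟨j, hj⟩ => hj ▸ j.2⟩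
  rw [himage, Finset.prod_map]
  rfl

lemma prod_le_prod_filter_val_lt_card {R : Type*} [CommSemiring R] [PartialOrder R]
    [IsOrderedRing R] {m : ℕ} {f : Fin m → R} (hf : Antitone f) (hf0 : ∀ i, 0 ≤ f i)
    (T : Finset (Fin m)) : ∏ i ∈ T, f i ≤ ∏ i with i.val < T.card, f i := by
  have hle : T.card ≤ m := T.card_le_univ.trans_eq (Fintype.card_fin m)
  calc ∏ i ∈ T, f i = ∏ j : Fin T.card, f (T.orderEmbOfFin rfl j) := by
        conv_lhs => rw [← Finset.image_orderEmbOfFin_univ T rfl,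
          Finset.prod_image (fun _ _ _ _ h => (T.orderEmbOfFin rfl).injective h)]
    _ ≤ ∏ j : Fin T.card, f (Fin.castLE hle j) :=
        Finset.prod_le_prod (fun _ _ => hf0 _) fun j _ => hf (castLE_le_orderEmbOfFin T hle j)
    _ = _ := (prod_filter_val_lt f hle).symm

end InitialProducts

section CompoundSpectral

open Matrix Unitary Set
open scoped Matrix.Norms.L2Operator

variable {ι : Type*} [Fintype ι] [LinearOrder ι] {A : Matrix ι ι ℂ} {k : ℕ}

/-- The compound of a unitary matrix, as a unitary matrix. -/
def compoundUnitary (k : ℕ) (U : unitaryGroup ι ℂ) : unitaryGroup (powersetCard ι k) ℂ :=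
  ⟨compound k (U : Matrix ι ι ℂ), by
    rw [mem_unitaryGroup_iff, star_eq_conjTranspose, ← compound_conjTranspose, ← compound_mul,
      ← star_eq_conjTranspose, mul_star_self_of_mem U.2, compound_one]⟩

lemma compound_conj_diagonal (U : unitaryGroup ι ℂ) (d : ι → ℝ) :
    compound k (conjStarAlgAut ℂ _ U (diagonal (Complex.ofReal ∘ d))) =
      conjStarAlgAut ℂ _ (compoundUnitary (ι := ι) k U)
        (diagonal (Complex.ofReal ∘ fun s : powersetCard ι k => ∏ i ∈ s.1, d i)) := by
  rw [conjStarAlgAut_apply, compound_mul, compound_mul, compound_diagonal, star_eq_conjTranspose,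
    compound_conjTranspose]
  simp only [Function.comp_def, Complex.ofReal_prod]
  rfl

lemma compound_rpow (hA : A.PosSemidef) (r : ℝ) : compound k (A ^ r) = compound k A ^ r := by
  have h0 : 0 ≤ hA.1.eigenvalues := hA.eigenvalues_nonneg
  have hpow : (fun s : powersetCard ι k => ∏ i ∈ s.1, hA.1.eigenvalues i ^ r) =
      fun s : powersetCard ι k => (∏ i ∈ s.1, hA.1.eigenvalues i) ^ r :=
    funext fun s => Real.finsetProd_rpow _ _ (fun i _ => h0 i) r
  have hspec : A = conjStarAlgAut ℂ _ _ (diagonal (Complex.ofReal ∘ hA.1.eigenvalues)) :=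
    hA.1.spectral_theorem
  rw [hspec, rpow_conj_diagonal _ h0, compound_conj_diagonal, compound_conj_diagonal,
    rpow_conj_diagonal _ fun s => Finset.prod_nonneg fun i _ => h0 i, hpow]

lemma posSemidef_compound (hA : A.PosSemidef) : (compound k A).PosSemidef := by
  obtain ⟨B, rfl⟩ := CStarAlgebra.nonneg_iff_eq_star_mul_self.1 hA.nonneg
  rw [star_eq_conjTranspose, compound_mul, compound_conjTranspose]
  exact posSemidef_conjTranspose_mul_self _

lemma norm_conj_diagonal {κ : Type*} [Fintype κ] [DecidableEq κ] (U : unitaryGroup κ ℂ)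
    (d : κ → ℝ) : ‖conjStarAlgAut ℂ _ U (diagonal (Complex.ofReal ∘ d))‖ = ‖d‖ := by
  rw [StarAlgEquiv.norm_map, l2_opNorm_diagonal]
  simp [Pi.norm_def]

lemma norm_eq_norm_eigenvalues (hA : A.PosSemidef) : ‖A‖ = ‖hA.1.eigenvalues‖ := by
  conv_lhs => rw [hA.1.spectral_theorem]
  exact norm_conj_diagonal _ _

lemma norm_compound_eq_norm_prod_eigenvalues (hA : A.PosSemidef) :
    ‖compound k A‖ = ‖fun s : powersetCard ι k => ∏ i ∈ s.1, hA.1.eigenvalues i‖ := by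
  conv_lhs => rw [hA.1.spectral_theorem]
  exact (congrArg norm (compound_conj_diagonal _ _)).trans (norm_conj_diagonal _ _)

lemma norm_compound_one (hA : A.PosSemidef) : ‖compound 1 A‖ = ‖A‖ := by
  rw [norm_compound_eq_norm_prod_eigenvalues hA, norm_eq_norm_eigenvalues hA]
  apply le_antisymm <;> refine (pi_norm_le_iff_of_nonneg (norm_nonneg _)).2 fun s => ?_
  · obtain ⟨i, hi⟩ := Finset.card_eq_one.1 s.2
    rw [hi, Finset.prod_singleton]
    exact norm_le_pi_norm hA.1.eigenvalues i
  · simpa using norm_le_pi_norm (fun s : powersetCard ι 1 => ∏ i ∈ s.1, hA.1.eigenvalues i)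
      ⟨{s}, Finset.card_singleton s⟩

lemma eigenvalues₀_nonneg (hA : A.PosSemidef) (i : Fin (Fintype.card ι)) :
    0 ≤ hA.1.eigenvalues₀ i := by
  simpa [IsHermitian.eigenvalues] using
    hA.eigenvalues_nonneg (Fintype.equivOfCardEq (Fintype.card_fin _) i)

lemma norm_compound (hA : A.PosSemidef) (hk : k ≤ Fintype.card ι) :
    ‖compound k A‖ = ∏ i with i.val < k, hA.1.eigenvalues₀ i := by
  set e : Fin (Fintype.card ι) ≃ ι := Fintype.equivOfCardEq (Fintype.card_fin _)
  have hprod (s : Finset ι) : ∏ i ∈ s, hA.1.eigenvalues i =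
      ∏ i ∈ s.map e.symm.toEmbedding, hA.1.eigenvalues₀ i := by
    rw [Finset.prod_map]
    rfl
  have hnorm (s : Finset ι) :
      ‖∏ i ∈ s, hA.1.eigenvalues i‖ = ∏ i ∈ s, hA.1.eigenvalues i :=
    Real.norm_of_nonneg (Finset.prod_nonneg fun i _ => hA.eigenvalues_nonneg i)
  rw [norm_compound_eq_norm_prod_eigenvalues hA]
  apply le_antisymm
  · refine (pi_norm_le_iff_of_nonneg
      (Finset.prod_nonneg fun i _ => eigenvalues₀_nonneg hA i)).2 fun s => ?_
    have hle := prod_le_prod_filter_val_lt_card hA.1.eigenvalues₀_antitone (eigenvalues₀_nonneg hA)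
      (s.1.map e.symm.toEmbedding)
    rw [Finset.card_map, s.2] at hle
    rwa [hnorm, hprod]
  · set top : Finset ι :=
      (Finset.univ.filter fun i : Fin (Fintype.card ι) => i.val < k).map e.toEmbedding with htop
    have hcard : top.card = k := by
      rw [Finset.card_map, Fin.card_filter_val_lt, min_eq_right hk]
    have hle := norm_le_pi_norm
      (fun s : powersetCard ι k => ∏ i ∈ s.1, hA.1.eigenvalues i) ⟨top, hcard⟩
    rw [hnorm, hprod] at hle
    simpa [htop, Finset.map_map] using hle

lemma norm_det_eq_prod_eigenvalues₀ (hA : A.PosSemidef) :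
    ‖A.det‖ = ∏ i, hA.1.eigenvalues₀ i := by
  rw [hA.1.det_eq_prod_eigenvalues, norm_prod,
    ← Equiv.prod_comp (Fintype.equivOfCardEq (Fintype.card_fin _)).symm]
  exact Finset.prod_congr rfl fun i _ => Complex.norm_of_nonneg (eigenvalues₀_nonneg hA _)

end CompoundSpectral

section LogMajorization

open Matrix
open scoped Matrix.Norms.L2Operator

variable {n : ℕ} {X Y : Matrix (Fin n) (Fin n) ℂ}

lemma logMaj_iff (hX : X.PosSemidef) (hY : Y.PosSemidef) :
    LogMaj X Y ↔ (∀ k, 1 ≤ k → k ≤ n → ‖compound k X‖ ≤ ‖compound k Y‖) ∧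
      ‖X.det‖ = ‖Y.det‖ := by
  have hnorm {Z : Matrix (Fin n) (Fin n) ℂ} (hZ : Z.PosSemidef) {k : ℕ} (hk : k ≤ n) :=
    norm_compound hZ (hk.trans_eq (Fintype.card_fin n).symm)
  rw [norm_det_eq_prod_eigenvalues₀ hX, norm_det_eq_prod_eigenvalues₀ hY]
  constructor
  · rintro ⟨_, _, hle, heq⟩
    exact ⟨fun k hk hkn => by simpa only [hnorm hX hkn, hnorm hY hkn] using hle k hk hkn, heq⟩
  · rintro ⟨hle, heq⟩
    exact ⟨hX, hY,
      fun k hk hkn => by simpa only [hnorm hX hkn, hnorm hY hkn] using hle k hk hkn, heq⟩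

lemma logMaj_rpow_iff (hX : X.PosSemidef) (hY : Y.PosSemidef) {s : ℝ} (hs : 0 < s) :
    LogMaj (X ^ s) (Y ^ s) ↔ LogMaj X Y := by
  have hnorm {Z : Matrix (Fin n) (Fin n) ℂ} (hZ : Z.PosSemidef) (k : ℕ) :
      ‖compound k (Z ^ s)‖ = ‖compound k Z‖ ^ s := by
    rw [compound_rpow hZ, CFC.norm_rpow _ hs (posSemidef_compound hZ).nonneg]
  rw [logMaj_iff (posSemidef_rpow X s) (posSemidef_rpow Y s), logMaj_iff hX hY]
  simp only [hnorm hX, hnorm hY, norm_det_rpow hX, norm_det_rpow hY,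
    Real.rpow_le_rpow_iff (norm_nonneg _) (norm_nonneg _) hs,
    Real.rpow_left_inj (norm_nonneg _) (norm_nonneg _) hs.ne']

end LogMajorization

section PosSemidefPowers

open Matrix

variable {ι : Type*} [Fintype ι] {A P W Z : Matrix ι ι ℂ} {r s : ℝ}

/-- `SupportedOn P Z` says that `Z` is unchanged by multiplication with `P` on either side. For an
orthogonal projection `P` and a Hermitian `Z` this means that the range of `Z` lies in that of
`P`. -/
def SupportedOn (P Z : Matrix ι ι ℂ) : Prop := P * Z = Z ∧ Z * P = Z

lemma SupportedOn.conj (hW : SupportedOn P W) (Z : Matrix ι ι ℂ) : SupportedOn P (W * Z * W) :=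
  ⟨by rw [← mul_assoc, ← mul_assoc, hW.1], by rw [mul_assoc, hW.2]⟩

variable [DecidableEq ι]

lemma continuousOn_spectrum (A : Matrix ι ι ℂ) (f : ℝ → ℝ) : ContinuousOn f (spectrum ℝ A) :=
  (finite_real_spectrum (A := A)).continuousOn f

lemma cfc_comp_of_isHermitian (hA : A.IsHermitian) (g f : ℝ → ℝ) :
    cfc g (cfc f A) = cfc (fun x => g (f x)) A :=
  (cfc_comp' g f A (((finite_real_spectrum (A := A)).image f).continuousOn g)
    (continuousOn_spectrum A f) hA).symm

lemma cfc_mul_cfc (A : Matrix ι ι ℂ) (f g : ℝ → ℝ) :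
    cfc f A * cfc g A = cfc (fun x => f x * g x) A :=
  (cfc_mul f g A (continuousOn_spectrum A f) (continuousOn_spectrum A g)).symm

lemma rpow_rpow_of_posSemidef (hA : A.PosSemidef) (r s : ℝ) : (A ^ r) ^ s = A ^ (r * s) := by
  rw [CFC.rpow_eq_cfc_real (posSemidef_rpow A r).nonneg, CFC.rpow_eq_cfc_real hA.nonneg,
    CFC.rpow_eq_cfc_real hA.nonneg, cfc_comp_of_isHermitian hA.1]
  exact cfc_congr fun x hx => (Real.rpow_mul (spectrum_nonneg_of_nonneg hA.nonneg hx) r s).symm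

lemma rpow_add_of_posSemidef (hA : A.PosSemidef) (h : r + s ≠ 0) :
    A ^ (r + s) = A ^ r * A ^ s := by
  rw [CFC.rpow_eq_cfc_real hA.nonneg, CFC.rpow_eq_cfc_real hA.nonneg,
    CFC.rpow_eq_cfc_real hA.nonneg, cfc_mul_cfc]
  exact cfc_congr fun x hx => Real.rpow_add' (spectrum_nonneg_of_nonneg hA.nonneg hx) h

lemma SupportedOn.rpow (hZ : Z.PosSemidef) (h : SupportedOn P Z) (hr : r ≠ 0) :
    SupportedOn P (Z ^ r) := by
  have hleft := rpow_add_of_posSemidef hZ (r := 1) (s := r - 1) (by simpa using hr)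
  have hright := rpow_add_of_posSemidef hZ (r := r - 1) (s := 1) (by simpa using hr)
  rw [add_sub_cancel, CFC.rpow_one Z hZ.nonneg] at hleft
  rw [sub_add_cancel, CFC.rpow_one Z hZ.nonneg] at hright
  exact ⟨by rw [hleft, ← mul_assoc, h.1], by rw [hright, mul_assoc, h.2]⟩

end PosSemidefPowers

section Support

open Matrix
open scoped Matrix.Norms.L2Operator

variable {n : ℕ} {A B X Y Z : Matrix (Fin n) (Fin n) ℂ} {α r : ℝ}

/-- `A + (1 - s(A))`, a positive definite matrix that agrees with the positive semidefinite
matrix `A` on the support of `A`. -/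
def fillKer (A : Matrix (Fin n) (Fin n) ℂ) : Matrix (Fin n) (Fin n) ℂ :=
  cfc (fun x : ℝ => if x = 0 then 1 else x) A

lemma isStrictlyPositive_fillKer (hA : A.PosSemidef) : IsStrictlyPositive (fillKer A) := by
  refine (cfc_isStrictlyPositive_iff _ A (continuousOn_spectrum A _) hA.1).2 fun x hx => ?_
  split_ifs with h
  · exact one_pos
  · exact (spectrum_nonneg_of_nonneg hA.nonneg hx).lt_of_ne' h

lemma supportedOn_supportProj_rpow (hA : A.PosSemidef) (hr : r ≠ 0) :
    SupportedOn (supportProj A) (A ^ r) := by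
  rw [SupportedOn, supportProj, CFC.rpow_eq_cfc_real hA.nonneg, cfc_mul_cfc, cfc_mul_cfc]
  constructor <;> exact cfc_congr fun x _ => by by_cases h : x = 0 <;> simp [h, hr]

lemma supportedOn_supportProj_self (hA : A.PosSemidef) : SupportedOn (supportProj A) A := by
  simpa only [CFC.rpow_one A hA.nonneg] using supportedOn_supportProj_rpow hA one_ne_zero

lemma isStarProjection_supportProj (A : Matrix (Fin n) (Fin n) ℂ) :
    IsStarProjection (supportProj A) := by
  refine ⟨?_, cfc_predicate _ _⟩
  rw [IsIdempotentElem, supportProj, cfc_mul_cfc]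
  exact cfc_congr fun x _ => by by_cases h : x = 0 <;> simp [h]

lemma supportedOn_of_supportProj_le (hB : B.PosSemidef) (h : supportProj B ≤ supportProj A) :
    SupportedOn (supportProj A) B := by
  obtain ⟨hl, hr⟩ := (isStarProjection_supportProj A).mul_right_and_mul_left_of_nonneg_of_le
    (isStarProjection_supportProj B).nonneg h
  obtain ⟨hBl, hBr⟩ := supportedOn_supportProj_self hB
  constructor
  · calc supportProj A * B = supportProj A * supportProj B * B := by rw [mul_assoc, hBl]
      _ = B := by rw [hr, hBl]
  · calc B * supportProj A = B * (supportProj B * supportProj A) := by rw [← mul_assoc, hBr]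
      _ = B := by rw [hl, hBr]

lemma supportProj_rpow (hA : A.PosSemidef) (hr : r ≠ 0) :
    supportProj (A ^ r) = supportProj A := by
  rw [supportProj, CFC.rpow_eq_cfc_real hA.nonneg, cfc_comp_of_isHermitian hA.1, supportProj]
  refine cfc_congr fun x hx => ?_
  simp [Real.rpow_eq_zero (spectrum_nonneg_of_nonneg hA.nonneg hx) hr]

lemma supportProj_eq_one (hA : A.PosDef) : supportProj A = 1 := by
  have hsa : IsSelfAdjoint A := hA.1
  rw [supportProj, ← cfc_one ℝ A]
  refine cfc_congr fun x hx => if_neg fun h0 => ?_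
  exact spectrum.zero_notMem ℝ hA.isUnit (h0 ▸ hx)

lemma fillKer_rpow_mul_supportProj (hA : A.PosSemidef) (hr : r ≠ 0) :
    fillKer A ^ r * supportProj A = A ^ r ∧ supportProj A * fillKer A ^ r = A ^ r := by
  rw [CFC.rpow_eq_cfc_real (isStrictlyPositive_fillKer hA).nonneg, fillKer,
    cfc_comp_of_isHermitian hA.1, supportProj, CFC.rpow_eq_cfc_real hA.nonneg, cfc_mul_cfc,
    cfc_mul_cfc]
  constructor <;> exact cfc_congr fun x _ => by by_cases h : x = 0 <;> simp [h, hr]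

lemma conj_fillKer_rpow (hA : A.PosSemidef) (hr : r ≠ 0) (hZ : SupportedOn (supportProj A) Z) :
    fillKer A ^ r * Z * fillKer A ^ r = A ^ r * Z * A ^ r := by
  obtain ⟨hright, hleft⟩ := fillKer_rpow_mul_supportProj hA hr
  calc _ = fillKer A ^ r * (supportProj A * Z * supportProj A) * fillKer A ^ r := by
        rw [hZ.1, hZ.2]
    _ = (fillKer A ^ r * supportProj A) * Z * (supportProj A * fillKer A ^ r) := by
        simp only [mul_assoc]
    _ = A ^ r * Z * A ^ r := by rw [hright, hleft]

lemma invGeoMean_fillKer (hX : X.PosSemidef) (hY : SupportedOn (supportProj X) Y)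
    (hY0 : 0 ≤ Y) : invGeoMean (fillKer X) Y = invGeoMean X Y := by
  have hhalf : (1 / 2 : ℝ) ≠ 0 := by norm_num
  have hconj := (supportedOn_supportProj_rpow hX hhalf).conj Y
  rw [invGeoMean, conj_fillKer_rpow hX hhalf hY, conj_fillKer_rpow hX (neg_ne_zero.2 hhalf)
    (hconj.rpow (nonneg_iff_posSemidef.1 (conj_rpow_nonneg hY0 X _)) hhalf), invGeoMean]

lemma specMean_fillKer (hX : X.PosSemidef) (hY : SupportedOn (supportProj X) Y) (hY0 : 0 ≤ Y)
    (hα : α ≠ 0) : specMean α (fillKer X) Y = specMean α X Y := by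
  have hG : SupportedOn (supportProj X) (invGeoMean X Y ^ α) :=
    ((supportedOn_supportProj_rpow hX (by norm_num)).conj _).rpow
      (nonneg_iff_posSemidef.1 (invGeoMean_nonneg X Y)) hα
  have hfill : fillKer X * supportProj X = X := by
    have := (fillKer_rpow_mul_supportProj hX one_ne_zero).1
    rwa [CFC.rpow_one _ (isStrictlyPositive_fillKer hX).nonneg, CFC.rpow_one X hX.nonneg] at this
  rw [specMean, invGeoMean_fillKer hX hY hY0]
  calc _ = invGeoMean X Y ^ α * fillKer X * (supportProj X * invGeoMean X Y ^ α) := by rw [hG.1]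
    _ = invGeoMean X Y ^ α * (fillKer X * supportProj X) * invGeoMean X Y ^ α := by
        simp only [mul_assoc]
    _ = specMean α X Y := by rw [hfill, specMean]

lemma renyiSandwich_fillKer (hX : X.PosSemidef) (hY : SupportedOn (supportProj X) Y)
    (hY0 : Y.PosSemidef) (hα : α ∈ Set.Ioo (0 : ℝ) 1) (hr : 0 < r) :
    renyiSandwich α r (fillKer X) Y = renyiSandwich α r X Y :=
  conj_fillKer_rpow hX (by have := sub_pos.2 hα.2; positivity)
    (hY.rpow hY0 (mul_pos hα.1 hr).ne')

end Support

section Sufficiency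

open Matrix Set
open scoped Matrix.Norms.L2Operator

variable {ι : Type*} [Fintype ι] {k : ℕ} {α r : ℝ}

lemma norm_det_specMean_rpow [DecidableEq ι] {X Y : Matrix ι ι ℂ} (hX : IsStrictlyPositive X)
    (hY : Y.PosSemidef) (α r : ℝ) : ‖(specMean α X Y).det‖ ^ r = ‖(renyiSandwich α r X Y).det‖ := by
  have hG : (invGeoMean X Y).PosSemidef := nonneg_iff_posSemidef.1 (invGeoMean_nonneg X Y)
  have hdetY := congrArg (‖det ·‖) (invGeoMean_mul_mul_self hX hY.nonneg)
  have hX0 : 0 < ‖X.det‖ := norm_pos_iff.2 ((isUnit_iff_isUnit_det X).1 hX.isUnit).ne_zero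
  have hXpow : ‖X.det‖ ^ ((1 - α) * r / 2) * ‖X.det‖ ^ (α * r) * ‖X.det‖ ^ ((1 - α) * r / 2) =
      ‖X.det‖ ^ r := by
    rw [← Real.rpow_add hX0, ← Real.rpow_add hX0]
    ring_nf
  simp only [specMean, renyiSandwich, det_mul, norm_mul, norm_det_rpow hG, norm_det_rpow hY,
    norm_det_rpow (nonneg_iff_posSemidef.1 hX.nonneg)] at hdetY ⊢
  rw [← hdetY, Real.mul_rpow (by positivity) (by positivity),
    Real.mul_rpow (by positivity) (by positivity), Real.mul_rpow (by positivity) (by positivity),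
    Real.mul_rpow (by positivity) (by positivity), ← Real.rpow_mul (norm_nonneg _), ← hXpow]
  ring

lemma posSemidef_renyiSandwich [DecidableEq ι] (α r : ℝ) (X Y : Matrix ι ι ℂ) :
    (renyiSandwich α r X Y).PosSemidef :=
  nonneg_iff_posSemidef.1 (renyiSandwich_nonneg α r X Y)

variable [LinearOrder ι] {X Y : Matrix ι ι ℂ}

lemma isStrictlyPositive_compound (hX : IsStrictlyPositive X) :
    IsStrictlyPositive (compound k X) := by
  refine IsStrictlyPositive.iff_of_unital.2
    ⟨(posSemidef_compound (nonneg_iff_posSemidef.1 hX.nonneg)).nonneg, ?_⟩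
  obtain ⟨u, rfl⟩ := hX.isUnit
  refine IsUnit.of_mul_eq_one (compound k (↑u⁻¹ : Matrix ι ι ℂ)) ?_
  rw [← compound_mul, u.mul_inv, compound_one]

lemma compound_specMean (α : ℝ) (hX : X.PosSemidef) (hY : Y.PosSemidef) :
    compound k (specMean α X Y) = specMean α (compound k X) (compound k Y) := by
  have hconj : (X ^ (1 / 2 : ℝ) * Y * X ^ (1 / 2 : ℝ)).PosSemidef :=
    nonneg_iff_posSemidef.1 (conj_rpow_nonneg hY.nonneg X _)
  have hG : (invGeoMean X Y).PosSemidef := nonneg_iff_posSemidef.1 (invGeoMean_nonneg X Y)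
  simp only [specMean, compound_mul, compound_rpow hG]
  simp only [invGeoMean, compound_mul, compound_rpow hX, compound_rpow hconj]

lemma compound_renyiSandwich (α r : ℝ) (hX : X.PosSemidef) (hY : Y.PosSemidef) :
    compound k (renyiSandwich α r X Y) = renyiSandwich α r (compound k X) (compound k Y) := by
  simp only [renyiSandwich, compound_mul, compound_rpow hX, compound_rpow hY]

lemma norm_compound_specMean_rpow (hX : X.PosSemidef) (hY : Y.PosSemidef) (hr : 0 < r) :
    ‖compound k (specMean α X Y ^ r)‖ = ‖specMean α (compound k X) (compound k Y)‖ ^ r := by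
  have hS : (specMean α X Y).PosSemidef := nonneg_iff_posSemidef.1 (specMean_nonneg α hX.nonneg Y)
  rw [compound_rpow hS, CFC.norm_rpow _ hr (posSemidef_compound hS).nonneg,
    compound_specMean α hX hY]

variable {n : ℕ} {X Y : Matrix (Fin n) (Fin n) ℂ}

lemma logMaj_specMean_rpow_of_isStrictlyPositive (hX : IsStrictlyPositive X) (hY : Y.PosSemidef)
    (hα : α ∈ Ioo (0 : ℝ) 1) (hr : 1 ≤ α * r) (hr' : 1 ≤ (1 - α) * r) :
    LogMaj (specMean α X Y ^ r) (renyiSandwich α r X Y) := by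
  have hr0 : 0 < r := pos_of_mul_pos_right (zero_lt_one.trans_le hr) hα.1.le
  have hX0 : X.PosSemidef := nonneg_iff_posSemidef.1 hX.nonneg
  refine (logMaj_iff (posSemidef_rpow _ r) (posSemidef_renyiSandwich α r X Y)).2
    ⟨fun k _ _ => ?_, ?_⟩
  · rw [norm_compound_specMean_rpow hX0 hY hr0, compound_renyiSandwich α r hX0 hY]
    have hXk : IsStrictlyPositive (compound k X) := isStrictlyPositive_compound hX
    exact norm_specMean_rpow_le_of_forall_isStrictlyPositive hα.1 hr0
      (fun Z hZ => norm_specMean_rpow_le hXk hZ hα hr hr') (posSemidef_compound hY).nonneg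
  · rw [norm_det_rpow (nonneg_iff_posSemidef.1 (specMean_nonneg α hX.nonneg Y)),
      norm_det_specMean_rpow hX hY]

lemma logMaj_renyiSandwich_of_isStrictlyPositive (hX : IsStrictlyPositive X) (hY : Y.PosSemidef)
    (hα : α ∈ Ioo (0 : ℝ) 1) (hr0 : 0 < r) (hr : α * r ≤ 1) (hr' : (1 - α) * r ≤ 1) :
    LogMaj (renyiSandwich α r X Y) (specMean α X Y ^ r) := by
  have hX0 : X.PosSemidef := nonneg_iff_posSemidef.1 hX.nonneg
  refine (logMaj_iff (posSemidef_renyiSandwich α r X Y) (posSemidef_rpow _ r)).2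
    ⟨fun k _ _ => ?_, ?_⟩
  · rw [norm_compound_specMean_rpow hX0 hY hr0, compound_renyiSandwich α r hX0 hY]
    have hXk : IsStrictlyPositive (compound k X) := isStrictlyPositive_compound hX
    exact norm_renyiSandwich_le_of_forall_isStrictlyPositive hα.1 hr0
      (fun Z hZ => norm_renyiSandwich_le hXk hZ hα hr0 hr hr') (posSemidef_compound hY).nonneg
  · rw [norm_det_rpow (nonneg_iff_posSemidef.1 (specMean_nonneg α hX.nonneg Y)),
      norm_det_specMean_rpow hX hY]

lemma logMaj_specMean_rpow (hX : X.PosSemidef) (hY : Y.PosSemidef)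
    (hXY : SupportedOn (supportProj X) Y) (hα : α ∈ Ioo (0 : ℝ) 1) (hr : 1 ≤ α * r)
    (hr' : 1 ≤ (1 - α) * r) : LogMaj (specMean α X Y ^ r) (renyiSandwich α r X Y) := by
  have hr0 : 0 < r := pos_of_mul_pos_right (zero_lt_one.trans_le hr) hα.1.le
  rw [← specMean_fillKer hX hXY hY.nonneg hα.1.ne', ← renyiSandwich_fillKer hX hXY hY hα hr0]
  exact logMaj_specMean_rpow_of_isStrictlyPositive (isStrictlyPositive_fillKer hX) hY hα hr hr'

lemma logMaj_renyiSandwich (hX : X.PosSemidef) (hY : Y.PosSemidef)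
    (hXY : SupportedOn (supportProj X) Y) (hα : α ∈ Ioo (0 : ℝ) 1) (hr0 : 0 < r)
    (hr : α * r ≤ 1) (hr' : (1 - α) * r ≤ 1) :
    LogMaj (renyiSandwich α r X Y) (specMean α X Y ^ r) := by
  rw [← specMean_fillKer hX hXY hY.nonneg hα.1.ne', ← renyiSandwich_fillKer hX hXY hY hα hr0]
  exact logMaj_renyiSandwich_of_isStrictlyPositive (isStrictlyPositive_fillKer hX) hY hα hr0 hr hr'

end Sufficiency

section Normalization

open Matrix Set
open scoped Matrix.Norms.L2Operator

variable {n : ℕ} {A B X Y : Matrix (Fin n) (Fin n) ℂ} {α p q : ℝ}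

lemma LogMaj.norm_le [NeZero n] (h : LogMaj X Y) : ‖X‖ ≤ ‖Y‖ := by
  obtain ⟨hX, hY, -⟩ := id h
  have := ((logMaj_iff hX hY).1 h).1 1 le_rfl NeZero.one_le
  rwa [norm_compound_one hX, norm_compound_one hY] at this

lemma geoMean_half_rpow_neg_one (hA : A.PosSemidef) (B : Matrix (Fin n) (Fin n) ℂ) :
    geoMean (1 / 2) (A ^ (-1 : ℝ)) B = invGeoMean A B := by
  rw [geoMean, rpow_rpow_of_posSemidef hA, rpow_rpow_of_posSemidef hA, invGeoMean]
  norm_num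

lemma SG_rpow (α p q : ℝ) (A B : Matrix (Fin n) (Fin n) ℂ) :
    SG α p A B ^ q = specMean α (A ^ p) (B ^ p) ^ (q / p) := by
  have hA := posSemidef_rpow A p
  rw [SG, spectralGeoMean, geoMean_half_rpow_neg_one hA, ← specMean, rpow_rpow_of_posSemidef
    (nonneg_iff_posSemidef.1 (specMean_nonneg α hA.nonneg _)), one_div_mul_eq_div]

lemma renyiMean_rpow (α : ℝ) (hp : 0 < p) (hq : 0 < q) (hA : A.PosSemidef) (hB : B.PosSemidef) :
    renyiMean α q A B ^ q = renyiSandwich α (q / p) (A ^ p) (B ^ p) := by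
  have hexpA : (1 - α) / 2 * q = p * ((1 - α) * (q / p) / 2) := by field_simp
  have hexpB : α * q = p * (α * (q / p)) := by field_simp
  rw [renyiMean, rpow_rpow_of_posSemidef
    (nonneg_iff_posSemidef.1 (conj_rpow_nonneg CFC.rpow_nonneg A _)), one_div_mul_cancel hq.ne',
    CFC.rpow_one _ (conj_rpow_nonneg CFC.rpow_nonneg A _), renyiSandwich,
    rpow_rpow_of_posSemidef hA, rpow_rpow_of_posSemidef hB, hexpA, hexpB]

lemma logMaj_SG_renyiMean_iff (hp : 0 < p) (hq : 0 < q) (hA : A.PosSemidef) (hB : B.PosSemidef) :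
    LogMaj (SG α p A B) (renyiMean α q A B) ↔
      LogMaj (specMean α (A ^ p) (B ^ p) ^ (q / p)) (renyiSandwich α (q / p) (A ^ p) (B ^ p)) := by
  rw [← SG_rpow α p q, ← renyiMean_rpow α hp hq hA hB]
  exact (logMaj_rpow_iff (posSemidef_rpow _ _) (posSemidef_rpow _ _) hq).symm

lemma logMaj_renyiMean_SG_iff (hp : 0 < p) (hq : 0 < q) (hA : A.PosSemidef) (hB : B.PosSemidef) :
    LogMaj (renyiMean α q A B) (SG α p A B) ↔
      LogMaj (renyiSandwich α (q / p) (A ^ p) (B ^ p)) (specMean α (A ^ p) (B ^ p) ^ (q / p)) := by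
  rw [← SG_rpow α p q, ← renyiMean_rpow α hp hq hA hB]
  exact (logMaj_rpow_iff (posSemidef_rpow _ _) (posSemidef_rpow _ _) hq).symm

lemma supportedOn_rpow_of_supportProj_le (hA : A.PosSemidef) (hB : B.PosSemidef)
    (h : supportProj B ≤ supportProj A) (hp : p ≠ 0) :
    SupportedOn (supportProj (A ^ p)) (B ^ p) := by
  rw [supportProj_rpow hA hp]
  exact (supportedOn_of_supportProj_le hB h).rpow hB hp

lemma one_le_mul_div_iff {c : ℝ} (hp : 0 < p) (hq : 0 < q) : 1 ≤ c * (q / p) ↔ p / q ≤ c := by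
  rw [← mul_div_assoc, one_le_div hp, div_le_iff₀ hq]

lemma mul_div_le_one_iff {c : ℝ} (hp : 0 < p) (hq : 0 < q) : c * (q / p) ≤ 1 ↔ c ≤ p / q := by
  rw [← mul_div_assoc, div_le_one hp, le_div_iff₀ hq]

lemma logMaj_SG_renyiMean (hA : A.PosSemidef) (hB : B.PosSemidef)
    (hAB : supportProj B ≤ supportProj A) (hα : α ∈ Ioo (0 : ℝ) 1) (hp : 0 < p) (hq : 0 < q)
    (h : p / q ≤ min α (1 - α)) : LogMaj (SG α p A B) (renyiMean α q A B) :=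
  (logMaj_SG_renyiMean_iff hp hq hA hB).2 <| logMaj_specMean_rpow (posSemidef_rpow A p)
    (posSemidef_rpow B p) (supportedOn_rpow_of_supportProj_le hA hB hAB hp.ne') hα
    ((one_le_mul_div_iff hp hq).2 (le_min_iff.1 h).1)
    ((one_le_mul_div_iff hp hq).2 (le_min_iff.1 h).2)

lemma logMaj_renyiMean_SG (hA : A.PosSemidef) (hB : B.PosSemidef)
    (hAB : supportProj B ≤ supportProj A) (hα : α ∈ Ioo (0 : ℝ) 1) (hp : 0 < p) (hq : 0 < q)
    (h : max α (1 - α) ≤ p / q) : LogMaj (renyiMean α q A B) (SG α p A B) :=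
  (logMaj_renyiMean_SG_iff hp hq hA hB).2 <| logMaj_renyiSandwich (posSemidef_rpow A p)
    (posSemidef_rpow B p) (supportedOn_rpow_of_supportProj_le hA hB hAB hp.ne') hα (div_pos hq hp)
    ((mul_div_le_one_iff hp hq).2 (max_le_iff.1 h).1)
    ((mul_div_le_one_iff hp hq).2 (max_le_iff.1 h).2)

end Normalization

section Projection

open CFC

variable {𝒜 : Type*} [CStarAlgebra 𝒜] [PartialOrder 𝒜] [StarOrderedRing 𝒜] {e x : 𝒜} {α m r : ℝ}

lemma rpow_eq_self_of_isStarProjection (he : IsStarProjection e) (hr : r ≠ 0) : e ^ r = e := by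
  have hsa : IsSelfAdjoint e := he.isSelfAdjoint
  rw [rpow_eq_cfc_real he.nonneg]
  conv_rhs => rw [← cfc_id ℝ e]
  refine cfc_congr fun t ht => ?_
  obtain rfl | rfl : t = 0 ∨ t = 1 := he.isIdempotentElem.spectrum_subset ℝ ht
  · exact Real.zero_rpow hr
  · exact Real.one_rpow r

lemma invGeoMean_eq_smul_of_isStarProjection (he : IsStarProjection e) (hx : IsStrictlyPositive x)
    (hm : 0 < m) (h : e * x * e = m • e) : invGeoMean x e = m ^ (-(1 / 2) : ℝ) • e := by
  refine (eq_invGeoMean_of_mul_mul_self hx (smul_nonneg (by positivity) he.nonneg) ?_).symm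
  simp only [smul_mul_assoc, mul_smul_comm, h, smul_smul]
  rw [← mul_assoc, ← Real.rpow_add hm, ← Real.rpow_add_one hm.ne']
  norm_num

lemma specMean_eq_smul_of_isStarProjection (he : IsStarProjection e) (hx : IsStrictlyPositive x)
    (hm : 0 < m) (h : e * x * e = m • e) (hα : 0 < α) : specMean α x e = m ^ (1 - α) • e := by
  rw [specMean, invGeoMean_eq_smul_of_isStarProjection he hx hm h,
    smul_rpow (by positivity) he.nonneg (.inr hα.le), rpow_eq_self_of_isStarProjection he hα.ne']
  simp only [smul_mul_assoc, mul_smul_comm, h, smul_smul]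
  rw [← mul_assoc, ← Real.rpow_mul hm.le, ← Real.rpow_add hm, ← Real.rpow_add_one hm.ne']
  ring_nf

lemma norm_renyiSandwich_of_isStarProjection (he : IsStarProjection e)
    (hx : IsStrictlyPositive x) (hαr : α * r ≠ 0) :
    ‖renyiSandwich α r x e‖ = ‖e * x ^ ((1 - α) * r) * e‖ := by
  set u := x ^ ((1 - α) * r / 2)
  have hu : star u = u := isSelfAdjoint_rpow x _
  have hstar : star e = e := he.isSelfAdjoint
  have hee : e * e = e := he.isIdempotentElem
  calc ‖renyiSandwich α r x e‖ = ‖star (e * u) * (e * u)‖ := by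
        rw [renyiSandwich, rpow_eq_self_of_isStarProjection he hαr, star_mul, hu, hstar, mul_assoc,
          mul_assoc, ← mul_assoc e e, hee]
    _ = ‖(e * u) * star (e * u)‖ := by
        rw [CStarRing.norm_star_mul_self, CStarRing.norm_self_mul_star]
    _ = _ := by
        rw [star_mul, hu, hstar, mul_assoc, ← mul_assoc u u, ← rpow_add hx.isUnit, add_halves,
          mul_assoc]

end Projection

section Necessity

open Matrix
open scoped Matrix.Norms.L2Operator

variable {α p q r s : ℝ} {d : Fin 2 → ℝ}

/-- The rank-one projection of `ℂ²` onto the line spanned by `(1, 1)`. -/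
def halfOnes : Matrix (Fin 2) (Fin 2) ℂ := of fun _ _ => 1 / 2

lemma isStarProjection_halfOnes : IsStarProjection halfOnes := by
  constructor
  · ext i j
    simp [halfOnes, mul_apply]
  · ext i j
    simp [halfOnes, star_apply]

lemma norm_halfOnes : ‖halfOnes‖ = 1 := by
  have hne : halfOnes ≠ 0 := fun h => by
    simpa [halfOnes] using congrFun₂ h 0 0
  have h := CStarRing.norm_star_mul_self (x := halfOnes)
  rw [isStarProjection_halfOnes.isSelfAdjoint.star_eq,
    isStarProjection_halfOnes.isIdempotentElem.eq] at h
  exact (mul_eq_left₀ (norm_ne_zero_iff.2 hne)).1 h.symm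

lemma halfOnes_conj_diagonal (d : Fin 2 → ℝ) :
    halfOnes * diagonal (Complex.ofReal ∘ d) * halfOnes = ((d 0 + d 1) / 2) • halfOnes := by
  ext i j
  simp only [halfOnes, one_div, mul_apply, of_apply, diagonal_apply, Function.comp_apply,
    mul_ite, mul_zero, Finset.sum_ite_eq', Finset.mem_univ, ↓reduceIte, Fin.sum_univ_two,
    Fin.isValue, Matrix.smul_apply, Complex.real_smul, Complex.ofReal_div, Complex.ofReal_add,
    Complex.ofReal_ofNat]
  ring

lemma isStrictlyPositive_diagonal (hd : ∀ i, 0 < d i) :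
    IsStrictlyPositive (diagonal (Complex.ofReal ∘ d)) :=
  (PosDef.diagonal fun i => Complex.zero_lt_real.2 (hd i)).isStrictlyPositive

lemma norm_specMean_halfOnes (hd : ∀ i, 0 < d i) (hα : 0 < α) :
    ‖specMean α (diagonal (Complex.ofReal ∘ d)) halfOnes‖ = ((d 0 + d 1) / 2) ^ (1 - α) := by
  have hm : 0 < (d 0 + d 1) / 2 := half_pos (add_pos (hd 0) (hd 1))
  rw [specMean_eq_smul_of_isStarProjection isStarProjection_halfOnes
    (isStrictlyPositive_diagonal hd) hm (halfOnes_conj_diagonal d) hα, norm_smul, norm_halfOnes,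
    mul_one, Real.norm_of_nonneg (by positivity)]

lemma norm_renyiSandwich_halfOnes (hd : ∀ i, 0 < d i) (hαr : α * r ≠ 0) :
    ‖renyiSandwich α r (diagonal (Complex.ofReal ∘ d)) halfOnes‖ =
      (d 0 ^ ((1 - α) * r) + d 1 ^ ((1 - α) * r)) / 2 := by
  have hpow : diagonal (Complex.ofReal ∘ d) ^ ((1 - α) * r) =
      diagonal (Complex.ofReal ∘ fun i => d i ^ ((1 - α) * r)) := by
    simpa using rpow_conj_diagonal 1 (fun i => (hd i).le) ((1 - α) * r)
  have hd0 := hd 0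
  have hd1 := hd 1
  rw [norm_renyiSandwich_of_isStarProjection isStarProjection_halfOnes
    (isStrictlyPositive_diagonal hd) hαr, hpow, halfOnes_conj_diagonal, norm_smul, norm_halfOnes,
    mul_one, Real.norm_of_nonneg (by positivity)]

lemma two_rpow_lt_of_one_lt (hs : 1 < s) : (2 : ℝ) ^ s < (1 + 3 ^ s) / 2 := by
  have h := (strictConvexOn_rpow hs).2 (show (1 : ℝ) ∈ Set.Ici 0 by norm_num)
    (show (3 : ℝ) ∈ Set.Ici 0 by norm_num) (by norm_num) one_half_pos one_half_pos (by norm_num)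
  norm_num at h
  linarith

lemma lt_two_rpow_of_lt_one (hs0 : 0 < s) (hs : s < 1) : (1 + 3 ^ s) / 2 < (2 : ℝ) ^ s := by
  have h := (Real.strictConcaveOn_rpow hs0 hs).2 (show (1 : ℝ) ∈ Set.Ici 0 by norm_num)
    (show (3 : ℝ) ∈ Set.Ici 0 by norm_num) (by norm_num) one_half_pos one_half_pos (by norm_num)
  norm_num at h
  linarith

lemma exists_norm_specMean_renyiSandwich (hα : 0 < α) (hr : 0 < r) :
    ∃ X Y : Matrix (Fin 2) (Fin 2) ℂ, IsStrictlyPositive X ∧ 0 ≤ Y ∧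
      ‖specMean α X Y‖ ^ r = 2 ^ ((1 - α) * r) ∧
      ‖renyiSandwich α r X Y‖ = (1 + 3 ^ ((1 - α) * r)) / 2 := by
  have hd : ∀ i, (0 : ℝ) < ![1, 3] i := by simp [Fin.forall_fin_two]
  refine ⟨_, halfOnes, isStrictlyPositive_diagonal hd, isStarProjection_halfOnes.nonneg, ?_, ?_⟩
  · rw [norm_specMean_halfOnes hd hα, ← Real.rpow_mul (by norm_num)]
    norm_num
  · rw [norm_renyiSandwich_halfOnes hd (mul_pos hα hr).ne']
    norm_num

lemma one_le_of_forall_norm_specMean_rpow_le (hα : α ∈ Set.Ioo (0 : ℝ) 1) (hr : 0 < r)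
    (h : ∀ X Y : Matrix (Fin 2) (Fin 2) ℂ, IsStrictlyPositive X → IsStrictlyPositive Y →
      ‖specMean α X Y‖ ^ r ≤ ‖renyiSandwich α r X Y‖) : 1 ≤ (1 - α) * r := by
  obtain ⟨X, Y, hX, hY, hspec, hrenyi⟩ := exists_norm_specMean_renyiSandwich hα.1 hr
  have hle := norm_specMean_rpow_le_of_forall_isStrictlyPositive hα.1 hr (h X · hX) hY
  rw [hspec, hrenyi] at hle
  by_contra! hlt
  exact hle.not_gt (lt_two_rpow_of_lt_one (mul_pos (sub_pos.2 hα.2) hr) hlt)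

lemma le_one_of_forall_norm_renyiSandwich_le (hα : 0 < α) (hr : 0 < r)
    (h : ∀ X Y : Matrix (Fin 2) (Fin 2) ℂ, IsStrictlyPositive X → IsStrictlyPositive Y →
      ‖renyiSandwich α r X Y‖ ≤ ‖specMean α X Y‖ ^ r) : (1 - α) * r ≤ 1 := by
  obtain ⟨X, Y, hX, hY, hspec, hrenyi⟩ := exists_norm_specMean_renyiSandwich hα hr
  have hle := norm_renyiSandwich_le_of_forall_isStrictlyPositive hα hr (h X · hX) hY
  rw [hspec, hrenyi] at hle
  by_contra! hlt
  exact hle.not_gt (two_rpow_lt_of_one_lt hlt)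

lemma exists_posDef_rpow_eq {ι : Type*} [Fintype ι] [DecidableEq ι] {X : Matrix ι ι ℂ}
    (hX : IsStrictlyPositive X) (hp : p ≠ 0) : ∃ A : Matrix ι ι ℂ, A.PosDef ∧ A ^ p = X :=
  ⟨X ^ p⁻¹, isStrictlyPositive_iff_posDef.1 (hX.rpow X _), by
    rw [rpow_rpow_of_isStrictlyPositive hX, inv_mul_cancel₀ hp, CFC.rpow_one X]⟩

lemma le_min_of_forall_logMaj (hα : α ∈ Set.Ioo (0 : ℝ) 1) (hp : 0 < p) (hq : 0 < q)
    (h : ∀ A B : Matrix (Fin 2) (Fin 2) ℂ, A.PosDef → B.PosDef →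
      LogMaj (SG α p A B) (renyiMean α q A B)) : p / q ≤ min α (1 - α) := by
  have hr : 0 < q / p := div_pos hq hp
  have hnorm : ∀ X Y : Matrix (Fin 2) (Fin 2) ℂ, IsStrictlyPositive X → IsStrictlyPositive Y →
      ‖specMean α X Y‖ ^ (q / p) ≤ ‖renyiSandwich α (q / p) X Y‖ := fun X Y hX hY => by
    obtain ⟨A, hA, rfl⟩ := exists_posDef_rpow_eq hX hp.ne'
    obtain ⟨B, hB, rfl⟩ := exists_posDef_rpow_eq hY hp.ne'
    rw [← CFC.norm_rpow _ hr (specMean_nonneg α hX.nonneg _)]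
    exact ((logMaj_SG_renyiMean_iff hp hq hA.posSemidef hB.posSemidef).1 (h A B hA hB)).norm_le
  have hswap := one_le_of_forall_norm_specMean_rpow_le (Set.Ioo.one_sub_mem hα) hr
    fun X Y hX hY => by
      rw [specMean_swap hY hX, norm_renyiSandwich_swap hY hX]
      exact hnorm Y X hY hX
  rw [sub_sub_cancel] at hswap
  exact le_min ((one_le_mul_div_iff hp hq).1 hswap)
    ((one_le_mul_div_iff hp hq).1 (one_le_of_forall_norm_specMean_rpow_le hα hr hnorm))

lemma max_le_of_forall_logMaj (hα : α ∈ Set.Ioo (0 : ℝ) 1) (hp : 0 < p) (hq : 0 < q)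
    (h : ∀ A B : Matrix (Fin 2) (Fin 2) ℂ, A.PosDef → B.PosDef →
      LogMaj (renyiMean α q A B) (SG α p A B)) : max α (1 - α) ≤ p / q := by
  have hr : 0 < q / p := div_pos hq hp
  have hnorm : ∀ X Y : Matrix (Fin 2) (Fin 2) ℂ, IsStrictlyPositive X → IsStrictlyPositive Y →
      ‖renyiSandwich α (q / p) X Y‖ ≤ ‖specMean α X Y‖ ^ (q / p) := fun X Y hX hY => by
    obtain ⟨A, hA, rfl⟩ := exists_posDef_rpow_eq hX hp.ne'
    obtain ⟨B, hB, rfl⟩ := exists_posDef_rpow_eq hY hp.ne'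
    rw [← CFC.norm_rpow _ hr (specMean_nonneg α hX.nonneg _)]
    exact ((logMaj_renyiMean_SG_iff hp hq hA.posSemidef hB.posSemidef).1 (h A B hA hB)).norm_le
  have hswap := le_one_of_forall_norm_renyiSandwich_le (sub_pos.2 hα.2) hr
    fun X Y hX hY => by
      rw [specMean_swap hY hX, norm_renyiSandwich_swap hY hX]
      exact hnorm Y X hY hX
  rw [sub_sub_cancel] at hswap
  exact max_le ((mul_div_le_one_iff hp hq).1 hswap)
    ((mul_div_le_one_iff hp hq).1 (le_one_of_forall_norm_renyiSandwich_le hα.1 hr hnorm))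

lemma supportProj_le_of_posDef {n : ℕ} {A : Matrix (Fin n) (Fin n) ℂ} (hA : A.PosDef)
    (B : Matrix (Fin n) (Fin n) ℂ) : supportProj B ≤ supportProj A :=
  (isStarProjection_supportProj B).le_one.trans_eq (supportProj_eq_one hA).symm

end Necessity

end

theorem theorem3p3 (α p q : ℝ) (hα0 : 0 < α) (hα1 : α < 1) (hp : 0 < p) (hq : 0 < q) :
    List.TFAE
      [∀ (n : ℕ) (A B : Matrix (Fin n) (Fin n) ℂ), A.PosSemidef → B.PosSemidef →
          supportProj B ≤ supportProj A → LogMaj (SG α p A B) (renyiMean α q A B),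
        ∀ A B : Matrix (Fin 2) (Fin 2) ℂ, A.PosDef → B.PosDef →
          LogMaj (SG α p A B) (renyiMean α q A B),
        p / q ≤ min α (1 - α)] ∧
    List.TFAE
      [∀ (n : ℕ) (A B : Matrix (Fin n) (Fin n) ℂ), A.PosSemidef → B.PosSemidef →
          supportProj B ≤ supportProj A → LogMaj (renyiMean α q A B) (SG α p A B),
        ∀ A B : Matrix (Fin 2) (Fin 2) ℂ, A.PosDef → B.PosDef →
          LogMaj (renyiMean α q A B) (SG α p A B),
        max α (1 - α) ≤ p / q] := by
  have hα : α ∈ Set.Ioo (0 : ℝ) 1 := ⟨hα0, hα1⟩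
  constructor
  · tfae_have 1 → 2 := fun h A B hA hB =>
      h 2 A B hA.posSemidef hB.posSemidef (supportProj_le_of_posDef hA B)
    tfae_have 2 → 3 := le_min_of_forall_logMaj hα hp hq
    tfae_have 3 → 1 := fun h n A B hA hB hAB => logMaj_SG_renyiMean hA hB hAB hα hp hq h
    tfae_finish
  · tfae_have 1 → 2 := fun h A B hA hB =>
      h 2 A B hA.posSemidef hB.posSemidef (supportProj_le_of_posDef hA B)
    tfae_have 2 → 3 := max_le_of_forall_logMaj hα hp hq
    tfae_have 3 → 1 := fun h n A B hA hB hAB => logMaj_renyiMean_SG hA hB hAB hα hp hq h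
    tfae_finish
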